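/- A graphic 2-XOR-CNF $\varphi$ over Boolean variables $x_1,\dots,x_n$ is a sequence of pairwise distinct clauses $C_1,\dots,C_m$, each of the form $x=y$ (that is, $x+y=0$ over $\mathrm{GF}(2)$) or $x\neq y$ (that is, $x+y=1$) with two distinct variables $x,y$. The signature produced by an assignment $a$ of the variables is the bit string $\sigma(a)=(C_1(a),\dots,C_m(a))\in\{0,1\}^m$, where $C_j(a)=1$ if $a$ satisfies $C_j$ and $C_j(a)=0$ otherwise; a signature is maximal if it is maximal among all signatures of $\varphi$ for the bitwise order. An edge-bicolored multigraph here has a finite vertex set and edges $e_1,\dots,e_m$, each colored red or blue and joining two distinct vertices, such that no two edges of the same color have the same end points. The multigraph $G(\varphi)$ has the variables of $\varphi$ as vertices, and its edge $e_j$ joins the two variables of $C_j$; it is blue if $C_j$ is $x\neq y$ and red if $C_j$ is $x=y$. A subgraph is given by its edge set $H$, its vertices being the end points of the edges in $H$. It is red-blue bipartite if its vertex set has a partition into two (possibly empty) parts $X,Y$ such that the edges of $H$ with one end point in $X$ and the other in $Y$ are exactly the blue edges of $H$. It is maximal if it is inclusion-maximal, as an edge set, among the red-blue bipartite subgraphs.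 Theorem. (1) There is an algorithm that, given a graphic 2-XOR-CNF $\varphi$, lists the maximal signatures of $\varphi$ without repetition, with polynomial delay and in polynomial space, if and only if there is an algorithm that, given a multigraph $G(\varphi)$ of a graphic 2-XOR-CNF, lists its maximal red-blue bipartite subgraphs without repetition, with polynomial delay and in polynomial space. (Polynomial delay: the time before the first output, between two consecutive outputs, and from the last output to the end is bounded by a polynomial in the length of the input. Polynomial space: the memory in use, with solutions not being kept after their output, is bounded by a polynomial in the length of the input.) (2) The map $\varphi\mapsto G(\varphi)$ is a bijection from the graphic 2-XOR-CNFs to the edge-bicolored multigraphs as above (with vertices identified with the variables). For every graphic 2-XOR-CNF $\varphi$ and every $\sigma\in\{0,1\}^m$, $\sigma$ is a maximal signature of $\varphi$ if and only if the subgraph $\{e_j : \sigma_j=1\}$ of $G(\varphi)$ is a maximal red-blue bipartite subgraph, and $\sigma\mapsto\{e_j:\sigma_j=1\}$ is a bijection from the maximal signatures of $\varphi$ to the maximal red-blue bipartite subgraphs of $G(\varphi)$. -/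

import Mathlib

/-! ### Enumeration algorithms -/

/-- An enumeration problem. Each instance `i` has a finite description `encodeInst i`, a type
`Sol i` of candidate solutions, an encoding of these, and the set `solutions i` to be listed. -/
structure EnumProblem where
  Instance : Type
  InSym : Type
  encodeInst : Instance → List InSym
  encodeInst_injective : Function.Injective encodeInst
  Sol : Instance → Type
  OutSym : Type
  encodeSol : (i : Instance) → Sol i → List OutSym
  encodeSol_injective : ∀ i, Function.Injective (encodeSol i)
  solutions : (i : Instance) → Set (Sol i)

/-- An enumeration machine: a finite multi-stack Turing machine, in which some labels are output
labels. Whenever the control of the machine is at an output label, the current content of the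
output stack `k₁` (top first) is output; the machine then goes on. -/
structure EnumMachine (InSym OutSym : Type) where
  tm : Turing.FinTM2
  finite_alphabets : ∀ k, Finite (tm.Γ k)
  inputAlphabet : tm.Γ tm.k₀ ≃ InSym
  outputAlphabet : tm.Γ tm.k₁ ≃ OutSym
  outputLabels : Set tm.Λ

namespace EnumMachine

variable {InSym OutSym : Type} (M : EnumMachine InSym OutSym)

/-- The configuration after `t` steps on input `w`; it is `none` once the machine has halted and
no step can be made any more. -/
def run (w : List InSym) (t : ℕ) : Option M.tm.Cfg :=
  (fun c => c.bind M.tm.step)^[t]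
    (some (Turing.initList M.tm (w.map M.inputAlphabet.symm)))

/-- On input `w`, the word `out` is output at time `t`. -/
def OutputsAt (w : List InSym) (t : ℕ) (out : List OutSym) : Prop :=
  ∃ c : M.tm.Cfg, M.run w t = some c ∧ (∃ l ∈ M.outputLabels, c.l = some l) ∧
    (c.stk M.tm.k₁).map M.outputAlphabet = out

/-- On input `w`, the machine outputs exactly the words in `S`, each exactly once. -/
def Enumerates (w : List InSym) (S : Set (List OutSym)) : Prop :=
  (∀ out, (∃ t, M.OutputsAt w t out) ↔ out ∈ S) ∧
    ∀ s t out, M.OutputsAt w s out → M.OutputsAt w t out → s = t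

/-- On input `w`, from the start and from any later moment at which the machine still runs, at
most `d` steps pass until the next output or the end of the computation. In particular this bounds
the time before the first output, between two consecutive outputs, and after the last one. -/
def DelayAtMost (w : List InSym) (d : ℕ) : Prop :=
  ∀ t, M.run w t ≠ none →
    ∃ s, t < s ∧ s ≤ t + d ∧ (M.run w s = none ∨ ∃ out, M.OutputsAt w s out)

/-- On input `w`, the stacks never hold more than `b` symbols in total. -/
def SpaceAtMost (w : List InSym) (b : ℕ) : Prop :=
  ∀ t c, M.run w t = some c → ∑ k ∈ M.tm.kFin.elems, (c.stk k).length ≤ b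

end EnumMachine

/-- There is an algorithm with polynomial delay and polynomial space (both in the length of the
description of the instance) that lists the solutions of every instance without repetition. -/
def EnumProblem.PolyDelayPolySpace (P : EnumProblem) : Prop :=
  ∃ (M : EnumMachine P.InSym P.OutSym) (d b : Polynomial ℕ), ∀ i : P.Instance,
    M.Enumerates (P.encodeInst i) (P.encodeSol i '' P.solutions i) ∧
    M.DelayAtMost (P.encodeInst i) (d.eval (P.encodeInst i).length) ∧
    M.SpaceAtMost (P.encodeInst i) (b.eval (P.encodeInst i).length)

/-! ### XOR formulas and signatures -/

/-- The XOR-clause `∑ x ∈ vars, x = rhs` over the two-element field, in the variables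
`x₀, …, x_{n-1}`. -/
@[ext] structure XORClause (n : ℕ) where
  vars : Finset (Fin n)
  rhs : ZMod 2

/-- A graphic 2-XOR-CNF: pairwise distinct clauses `C_0, …, C_{m-1}`, each of the form `x + y = 0`
(that is, `x = y`) or `x + y = 1` (that is, `x ≠ y`) with two distinct variables `x`, `y`. -/
structure GraphicXORCNF where
  n : ℕ
  m : ℕ
  clause : Fin m → XORClause n
  two_vars : ∀ j, (clause j).vars.card = 2
  distinct : Function.Injective clause

namespace GraphicXORCNF

variable (φ : GraphicXORCNF)

/-- The signature produced by the assignment `a`. -/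
def signature (a : Fin φ.n → ZMod 2) : Fin φ.m → Bool :=
  fun j => decide (∑ x ∈ (φ.clause j).vars, a x = (φ.clause j).rhs)

def IsSignature (σ : Fin φ.m → Bool) : Prop :=
  ∃ a, φ.signature a = σ

/-- Maximality is with respect to the bitwise order. -/
def IsMaximalSignature (σ : Fin φ.m → Bool) : Prop :=
  Maximal φ.IsSignature σ

end GraphicXORCNF

/-! ### Edge-bicolored multigraphs -/

inductive EdgeColor
  | red
  | blue
  deriving DecidableEq

@[ext] structure BicoloredEdge (n : ℕ) where
  ends : Finset (Fin n)
  color : EdgeColor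

/-- An edge-bicolored multigraph with vertices `0, …, n-1` and edges `e_0, …, e_{m-1}`, each with
two distinct end points, in which no two edges of the same color have the same end points. -/
structure BicoloredMultigraph where
  n : ℕ
  m : ℕ
  edge : Fin m → BicoloredEdge n
  two_ends : ∀ j, (edge j).ends.card = 2
  distinct : Function.Injective edge

namespace BicoloredMultigraph

variable (G : BicoloredMultigraph)

/-- The vertex set of the subgraph with edge set `H`: the end points of its edges. -/
def verts (H : Finset (Fin G.m)) : Finset (Fin G.n) :=
  H.biUnion fun j => (G.edge j).ends

/-- `B(H)`, the set of blue edges of `H`. -/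
def blueEdges (H : Finset (Fin G.m)) : Finset (Fin G.m) :=
  H.filter fun j => (G.edge j).color = EdgeColor.blue

/-- `δ_H(X, Y)`, the edges of `H` with one end point in `X` and the other in `Y`. -/
def crossingEdges (H : Finset (Fin G.m)) (X Y : Finset (Fin G.n)) : Finset (Fin G.m) :=
  H.filter fun j => ∃ x ∈ X, ∃ y ∈ Y, (G.edge j).ends = {x, y}

/-- The vertex set of the subgraph with edge set `H` has a bipartition `(X, Y)` (a part may be
empty) such that the edges of `H` between `X` and `Y` are exactly the blue edges of `H`. -/
def IsRedBlueBipartite (H : Finset (Fin G.m)) : Prop :=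
  ∃ X Y : Finset (Fin G.n), X ∪ Y = G.verts H ∧ Disjoint X Y ∧
    G.crossingEdges H X Y = G.blueEdges H

/-- Maximality is with respect to inclusion of edge sets. -/
def IsMaximalRedBlueBipartite (H : Finset (Fin G.m)) : Prop :=
  Maximal G.IsRedBlueBipartite H

end BicoloredMultigraph

/-! ### The multigraph of a formula -/

/-- A clause `x ≠ y` gives a blue edge `xy`, a clause `x = y` a red edge `xy`. -/
def XORClause.toEdge {n : ℕ} (C : XORClause n) : BicoloredEdge n where
  ends := C.vars
  color := if C.rhs = 1 then EdgeColor.blue else EdgeColor.red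

theorem XORClause.toEdge_injective {n : ℕ} :
    Function.Injective (XORClause.toEdge (n := n)) := by
  rintro ⟨v, r⟩ ⟨w, s⟩ h
  simp only [XORClause.toEdge, BicoloredEdge.mk.injEq] at h
  obtain ⟨rfl, h⟩ := h
  have key : ∀ r s : ZMod 2, (if r = 1 then EdgeColor.blue else EdgeColor.red) =
      (if s = 1 then EdgeColor.blue else EdgeColor.red) → r = s := by decide
  rw [key r s h]

/-- The multigraph `G(φ)`: its vertices are the variables of `φ`, and its edge `e_j` comes from the
clause `C_j`. -/
abbrev GraphicXORCNF.toGraph (φ : GraphicXORCNF) : BicoloredMultigraph where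
  n := φ.n
  m := φ.m
  edge j := (φ.clause j).toEdge
  two_ends := φ.two_vars
  distinct := XORClause.toEdge_injective.comp φ.distinct

/-- The subgraph `{e_j : σ[j] = 1}` of `G(φ)`. -/
def GraphicXORCNF.subgraphOf (φ : GraphicXORCNF) (σ : Fin φ.m → Bool) :
    Finset (Fin φ.toGraph.m) :=
  (Finset.univ.filter fun j : Fin φ.m => σ j = true : Finset (Fin φ.m))

/-! ### Encodings -/

/-- A number in binary, least significant bit first, followed by the separator `sep`. -/
def encodeNatSep {A : Type} (bit : Bool → A) (sep : A) (x : ℕ) : List A :=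
  (Computability.encodeNat x).map bit ++ [sep]

/-- The symbols in which formulas are written. -/
inductive FormulaSym
  | tick
  | bit (b : Bool)
  | plus
  | rhs (ε : ZMod 2)
  deriving DecidableEq

/-- A clause is written as its variables in increasing order, each in binary and followed by a
`plus`, and then the right-hand side. -/
def XORClause.encode {n : ℕ} (C : XORClause n) : List FormulaSym :=
  (C.vars.sort (· ≤ ·)).flatMap (fun x : Fin n => encodeNatSep FormulaSym.bit FormulaSym.plus x) ++
    [FormulaSym.rhs C.rhs]

/-- A formula is written as the number of variables in unary, followed by the list of its
clauses. -/
def GraphicXORCNF.encode (φ : GraphicXORCNF) : List FormulaSym :=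
  List.replicate φ.n FormulaSym.tick ++ (List.ofFn φ.clause).flatMap XORClause.encode

/-- The symbols in which multigraphs are written. -/
inductive GraphSym
  | tick
  | bit (b : Bool)
  | sep
  | color (c : EdgeColor)
  deriving DecidableEq

/-- An edge is written as its color, followed by its end points in increasing order, each in binary
and followed by a separator. -/
def BicoloredEdge.encode {n : ℕ} (e : BicoloredEdge n) : List GraphSym :=
  GraphSym.color e.color ::
    (e.ends.sort (· ≤ ·)).flatMap (fun x : Fin n => encodeNatSep GraphSym.bit GraphSym.sep x)

/-- A multigraph is written as the number of vertices in unary, followed by the list of its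
edges. -/
def BicoloredMultigraph.encode (G : BicoloredMultigraph) : List GraphSym :=
  List.replicate G.n GraphSym.tick ++ (List.ofFn G.edge).flatMap BicoloredEdge.encode

/-- A set of edges is written as its characteristic vector, with one bit for each of the edges
`e_0, …, e_{m-1}`. -/
def BicoloredMultigraph.encodeSubgraph (G : BicoloredMultigraph) (H : Finset (Fin G.m)) :
    List Bool :=
  List.ofFn fun j => decide (j ∈ H)

/-! The encodings are injective. -/

theorem encodeNatSep_append {A : Type} {bit : Bool → A} {sep : A}
    (hbit : Function.Injective bit) (hsep : ∀ b, bit b ≠ sep) {x y : ℕ} {s t : List A}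
    (h : encodeNatSep bit sep x ++ s = encodeNatSep bit sep y ++ t) : x = y ∧ s = t := by
  have key : ∀ u v : List Bool, u.map bit ++ [sep] ++ s = v.map bit ++ [sep] ++ t →
      u = v ∧ s = t := by
    intro u
    induction u with
    | nil =>
      intro v hv
      cases v with
      | nil => simpa using hv
      | cons b v => exact absurd (List.cons.inj hv).1.symm (hsep b)
    | cons a u ih =>
      intro v hv
      cases v with
      | nil => exact absurd (List.cons.inj hv).1 (hsep a)
      | cons b v =>
        obtain ⟨h1, h2⟩ := List.cons.inj hv
        obtain ⟨h3, h4⟩ := ih v h2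
        exact ⟨by rw [hbit h1, h3], h4⟩
  obtain ⟨h1, h2⟩ := key _ _ h
  refine ⟨?_, h2⟩
  rw [← Computability.decode_encodeNat x, h1, Computability.decode_encodeNat]

theorem encodePair_append {A : Type} {bit : Bool → A} {sep : A}
    (hbit : Function.Injective bit) (hsep : ∀ b, bit b ≠ sep) {n : ℕ} {V W : Finset (Fin n)}
    (hV : V.card = 2) (hW : W.card = 2) {s t : List A}
    (h : (V.sort (· ≤ ·)).flatMap (fun x : Fin n => encodeNatSep bit sep x) ++ s =
      (W.sort (· ≤ ·)).flatMap (fun x : Fin n => encodeNatSep bit sep x) ++ t) : V = W ∧ s = t := by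
  have hV' : (V.sort (· ≤ ·)).length = 2 := by rw [Finset.length_sort, hV]
  have hW' : (W.sort (· ≤ ·)).length = 2 := by rw [Finset.length_sort, hW]
  obtain ⟨a, b, hab⟩ := List.length_eq_two.1 hV'
  obtain ⟨c, d, hcd⟩ := List.length_eq_two.1 hW'
  rw [hab, hcd] at h
  simp only [List.flatMap_cons, List.flatMap_nil, List.append_nil, List.append_assoc] at h
  obtain ⟨h1, h2⟩ := encodeNatSep_append hbit hsep h
  obtain ⟨h3, h4⟩ := encodeNatSep_append hbit hsep h2
  refine ⟨?_, h4⟩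
  rw [← Finset.sort_toFinset V (· ≤ ·), ← Finset.sort_toFinset W (· ≤ ·), hab, hcd,
    Fin.ext h1, Fin.ext h3]

theorem flatMap_inj_of_prefix {A B : Type} {P : B → Prop} {f : B → List A}
    (hne : ∀ x, f x ≠ [])
    (hf : ∀ x y s t, P x → P y → f x ++ s = f y ++ t → x = y ∧ s = t) :
    ∀ u v : List B, (∀ x ∈ u, P x) → (∀ x ∈ v, P x) → u.flatMap f = v.flatMap f → u = v := by
  intro u
  induction u with
  | nil =>
    intro v _ _ h
    cases v with
    | nil => rfl
    | cons b v => simp [hne] at h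
  | cons a u ih =>
    intro v hu hv h
    cases v with
    | nil => simp [hne] at h
    | cons b v =>
      simp only [List.flatMap_cons] at h
      obtain ⟨h1, h2⟩ := hf _ _ _ _ (hu a (by simp)) (hv b (by simp)) h
      rw [h1, ih v (fun x hx => hu x (by simp [hx])) (fun x hx => hv x (by simp [hx])) h2]

theorem replicate_append_inj {A : Type} {c : A} :
    ∀ (n k : ℕ) (s t : List A), c ∉ s → c ∉ t →
      List.replicate n c ++ s = List.replicate k c ++ t → n = k ∧ s = t := by
  intro n
  induction n with
  | zero =>
    intro k s t hs _ h
    cases k with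
    | zero => simpa using h
    | succ k => exact absurd (by simp [show s = _ from h, List.replicate_succ]) hs
  | succ n ih =>
    intro k s t hs ht h
    cases k with
    | zero => exact absurd (by simp [← show _ = t from h, List.replicate_succ]) ht
    | succ k =>
      simp only [List.replicate_succ, List.cons_append, List.cons.injEq, true_and] at h
      obtain ⟨h1, h2⟩ := ih k s t hs ht h
      exact ⟨by rw [h1], h2⟩

theorem GraphicXORCNF.encode_injective : Function.Injective GraphicXORCNF.encode := by
  rintro ⟨n, m, C, hC, dC⟩ ⟨n', m', D, hD, dD⟩ h
  have tick_not_mem : ∀ {n : ℕ} (l : List (XORClause n)),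
      FormulaSym.tick ∉ l.flatMap XORClause.encode := by
    intro n l
    simp [XORClause.encode, encodeNatSep]
  obtain ⟨rfl, h2⟩ := replicate_append_inj _ _ _ _ (tick_not_mem _) (tick_not_mem _) h
  have h3 := flatMap_inj_of_prefix (P := fun K : XORClause n => K.vars.card = 2)
    (by simp [XORClause.encode])
    (by
      intro K L s t hK hL hKL
      simp only [XORClause.encode, List.append_assoc] at hKL
      obtain ⟨h4, h5⟩ := encodePair_append (fun _ _ hb => FormulaSym.bit.inj hb)
        (by simp) hK hL hKL
      simp only [List.singleton_append, List.cons.injEq, FormulaSym.rhs.injEq] at h5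
      exact ⟨XORClause.ext h4 h5.1, h5.2⟩)
    _ _ (by simpa using hC) (by simpa using hD) h2
  obtain rfl : m = m' := by simpa using congrArg List.length h3
  obtain rfl : C = D := List.ofFn_injective h3
  rfl

theorem BicoloredMultigraph.encode_injective :
    Function.Injective BicoloredMultigraph.encode := by
  rintro ⟨n, m, C, hC, dC⟩ ⟨n', m', D, hD, dD⟩ h
  have tick_not_mem : ∀ {n : ℕ} (l : List (BicoloredEdge n)),
      GraphSym.tick ∉ l.flatMap BicoloredEdge.encode := by
    intro n l
    simp [BicoloredEdge.encode, encodeNatSep]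
  obtain ⟨rfl, h2⟩ := replicate_append_inj _ _ _ _ (tick_not_mem _) (tick_not_mem _) h
  have h3 := flatMap_inj_of_prefix (P := fun K : BicoloredEdge n => K.ends.card = 2)
    (by simp [BicoloredEdge.encode])
    (by
      intro K L s t hK hL hKL
      simp only [BicoloredEdge.encode, List.cons_append, List.cons.injEq,
        GraphSym.color.injEq] at hKL
      obtain ⟨h4, h5⟩ := encodePair_append (fun _ _ hb => GraphSym.bit.inj hb)
        (by simp) hK hL hKL.2
      exact ⟨BicoloredEdge.ext h4 hKL.1, h5⟩)
    _ _ (by simpa using hC) (by simpa using hD) h2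
  obtain rfl : m = m' := by simpa using congrArg List.length h3
  obtain rfl : C = D := List.ofFn_injective h3
  rfl

theorem BicoloredMultigraph.encodeSubgraph_injective (G : BicoloredMultigraph) :
    Function.Injective G.encodeSubgraph := by
  intro H K h
  ext j
  simpa using congrFun (List.ofFn_injective h) j

/-! ### The two enumeration problems -/

/-- Given a graphic 2-XOR-CNF, list its maximal signatures, written as bit strings. -/
abbrev maximalSignatures : EnumProblem where
  Instance := GraphicXORCNF
  InSym := FormulaSym
  encodeInst := GraphicXORCNF.encode
  encodeInst_injective := GraphicXORCNF.encode_injective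
  Sol φ := Fin φ.m → Bool
  OutSym := Bool
  encodeSol _ σ := List.ofFn σ
  encodeSol_injective _ := List.ofFn_injective
  solutions φ := {σ | φ.IsMaximalSignature σ}

/-- Given an edge-bicolored multigraph, list its maximal red-blue bipartite subgraphs. -/
abbrev maximalRedBlueBipartiteSubgraphs : EnumProblem where
  Instance := BicoloredMultigraph
  InSym := GraphSym
  encodeInst := BicoloredMultigraph.encode
  encodeInst_injective := BicoloredMultigraph.encode_injective
  Sol G := Finset (Fin G.m)
  OutSym := Bool
  encodeSol G H := G.encodeSubgraph H
  encodeSol_injective G := G.encodeSubgraph_injective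
  solutions G := {H | G.IsMaximalRedBlueBipartite H}

/-! ### Signatures and red-blue bipartite subgraphs -/

/-! Read an assignment `a` as the cut between the variables with value 1 and the others. A clause
holds exactly when its edge crosses the cut if and only if it is blue. Hence the subgraph of a
signature is red-blue bipartite (`IsSignature.isRedBlueBipartite`), and a bipartition `(X, Y)` of a
red-blue bipartite subgraph `H` gives an assignment satisfying at least the clauses of `H`
(`exists_isSignature_le`). The subgraphs of signatures are therefore cofinal among the red-blue
bipartite ones, so both families have the same maximal elements (`isMaximalSignature_iff`).

For the algorithms, the words to be listed coincide (`image_encodeSubgraph`), so only the input has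
to be translated. The two descriptions agree letter by letter, except that a clause ends with its
right-hand side while an edge begins with its color. One pass that holds back a single letter moves
each such letter across the end points: `delayMap`, realized by `rewriteInput`. Since a pass writes
onto a stack, it also reverses the word; a second pass, with the identity, repairs the direction.
Each pass adds linear time before the first output and linear space (`Lists.rewriteInput`). -/

theorem GraphicXORCNF.toGraph_bijective : Function.Bijective GraphicXORCNF.toGraph := by
  constructor
  · rintro ⟨n, m, C, hC, dC⟩ ⟨n', m', D, hD, dD⟩ h
    injection h with hn hm h
    subst hn hm
    obtain rfl : C = D := funext fun j => XORClause.toEdge_injective (congrFun (eq_of_heq h) j)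
    rfl
  · rintro ⟨n, m, e, he, de⟩
    have key : ∀ j, (XORClause.mk (e j).ends (if (e j).color = .blue then 1 else 0)).toEdge =
        e j := by
      intro j
      rcases h : e j with ⟨s, c⟩
      cases c <;> simp [XORClause.toEdge]
    refine ⟨⟨n, m, fun j => ⟨(e j).ends, if (e j).color = .blue then 1 else 0⟩, he, ?_⟩, ?_⟩
    · intro i j hij
      apply de
      rw [← key i, ← key j]
      exact congrArg _ hij
    -- The types of the proof fields depend on the edge map, so the equality of edge maps is
    -- substituted for a variable `f`.
    · have mk_eq : ∀ (f : Fin m → BicoloredEdge n) (hf) (df), f = e →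
          BicoloredMultigraph.mk n m f hf df = ⟨n, m, e, he, de⟩ := by
        rintro _ _ _ rfl
        rfl
      exact mk_eq _ _ _ (funext key)

namespace GraphicXORCNF

variable (φ : GraphicXORCNF)

theorem mem_subgraphOf {σ : Fin φ.m → Bool} {j : Fin φ.m} :
    j ∈ φ.subgraphOf σ ↔ σ j = true := by
  simp [subgraphOf]

theorem subgraphOf_le_iff {σ τ : Fin φ.m → Bool} :
    φ.subgraphOf σ ≤ φ.subgraphOf τ ↔ σ ≤ τ := by
  rw [Pi.le_def]
  refine forall_congr' fun j => ?_
  rw [mem_subgraphOf, mem_subgraphOf]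
  cases σ j <;> cases τ j <;> simp

theorem subgraphOf_bijective : Function.Bijective φ.subgraphOf := by
  constructor
  · intro σ τ h
    exact le_antisymm (φ.subgraphOf_le_iff.1 h.le) (φ.subgraphOf_le_iff.1 h.ge)
  · intro H
    refine ⟨fun j : Fin φ.m => decide (j ∈ H), ?_⟩
    ext j
    exact φ.mem_subgraphOf.trans decide_eq_true_iff

theorem signature_pair {a : Fin φ.n → ZMod 2} {j : Fin φ.m} {x y : Fin φ.n} (hxy : x ≠ y)
    (h : (φ.clause j).vars = {x, y}) :
    φ.signature a j = true ↔ a x + a y = (φ.clause j).rhs := by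
  simp [signature, h, Finset.sum_pair hxy]

theorem color_eq_blue {n : ℕ} (C : XORClause n) : C.toEdge.color = .blue ↔ C.rhs = 1 := by
  simp [XORClause.toEdge]

/-- Passes from the equation to the cut: a sum of two bits is 1 exactly when one and only one of
them is 1, that is, when the edge crosses. -/
theorem zmod_two_add_iff : ∀ a b r : ZMod 2, a + b = r ↔
    ((a = 1 ∧ b ≠ 1 ∨ b = 1 ∧ a ≠ 1) ↔ r = 1) := by
  decide

/-- The subgraph of a signature is red-blue bipartite. -/
theorem IsSignature.isRedBlueBipartite {σ : Fin φ.m → Bool} (h : φ.IsSignature σ) :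
    φ.toGraph.IsRedBlueBipartite (φ.subgraphOf σ) := by
  obtain ⟨a, rfl⟩ := h
  set V := φ.toGraph.verts (φ.subgraphOf (φ.signature a)) with hV
  refine ⟨V.filter fun x => a x = 1, V.filter fun x => ¬ a x = 1,
    Finset.filter_union_filter_not_eq _ _, Finset.disjoint_filter_filter_not _ _ _, ?_⟩
  refine Finset.filter_congr fun j hj => ?_
  obtain ⟨x, y, hxy, he⟩ := Finset.card_eq_two.1 (φ.two_vars j)
  have hsub : (φ.clause j).vars ⊆ V := Finset.subset_biUnion_of_mem
    (fun j => (φ.toGraph.edge j).ends) hj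
  have hx : x ∈ V := hsub (by simp [he])
  have hy : y ∈ V := hsub (by simp [he])
  have hs := (zmod_two_add_iff _ _ _).1 ((φ.signature_pair hxy he).1 (φ.mem_subgraphOf.1 hj))
  rw [color_eq_blue, ← hs]
  change (∃ u ∈ _, ∃ v ∈ _, (φ.clause j).vars = {u, v}) ↔ _
  rw [he]
  constructor
  · rintro ⟨u, hu, v, hv, huv⟩
    simp only [Finset.mem_filter] at hu hv
    have : x = u ∧ y = v ∨ x = v ∧ y = u := by
      have h1 : x ∈ ({u, v} : Finset (Fin φ.n)) := huv ▸ by simp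
      have h2 : y ∈ ({u, v} : Finset (Fin φ.n)) := huv ▸ by simp
      simp only [Finset.mem_insert, Finset.mem_singleton] at h1 h2
      grind
    rcases this with ⟨rfl, rfl⟩ | ⟨rfl, rfl⟩
    · exact Or.inl ⟨hu.2, hv.2⟩
    · exact Or.inr ⟨hu.2, hv.2⟩
  · rintro (⟨h1, h2⟩ | ⟨h1, h2⟩)
    · exact ⟨x, by simp [hx, h1], y, by simp [hy, h2], rfl⟩
    · exact ⟨y, by simp [hy, h1], x, by simp [hx, h2], Finset.pair_comm _ _⟩

/-- Every red-blue bipartite subgraph is contained in the subgraph of a signature. -/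
theorem exists_isSignature_le {H : Finset (Fin φ.m)} (h : φ.toGraph.IsRedBlueBipartite H) :
    ∃ σ, φ.IsSignature σ ∧ H ≤ φ.subgraphOf σ := by
  obtain ⟨X, Y, hXY, hd, hc⟩ := h
  -- Vertices outside `X ∪ Y` also get 0; this is harmless, as no edge of `H` meets them. Clauses
  -- outside `H` may become satisfied, hence only an inclusion.
  refine ⟨_, ⟨fun x => if x ∈ X then 1 else 0, rfl⟩, fun j hj => ?_⟩
  obtain ⟨x, y, hxy, he⟩ := Finset.card_eq_two.1 (φ.two_vars j)
  rw [mem_subgraphOf, φ.signature_pair hxy he, zmod_two_add_iff, ← color_eq_blue]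
  have hsub : (φ.clause j).vars ⊆ X ∪ Y := hXY ▸ Finset.subset_biUnion_of_mem
    (fun j => (φ.toGraph.edge j).ends) hj
  have hx : x ∈ X ∪ Y := hsub (by simp [he])
  have hy : y ∈ X ∪ Y := hsub (by simp [he])
  rw [Finset.mem_union] at hx hy
  rw [Finset.disjoint_left] at hd
  have hiff : (∃ u ∈ X, ∃ v ∈ Y, (φ.clause j).vars = {u, v}) ↔
      (φ.clause j).toEdge.color = .blue := by
    have hmem := Finset.ext_iff.1 hc j
    exact ⟨fun h => (Finset.mem_filter.1 (hmem.1 (Finset.mem_filter.2 ⟨hj, h⟩))).2,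
      fun h => (Finset.mem_filter.1 (hmem.2 (Finset.mem_filter.2 ⟨hj, h⟩))).2⟩
  rw [← hiff, he]
  have h01 : ∀ z, (if z ∈ X then (1 : ZMod 2) else 0) = 1 ↔ z ∈ X := fun z => by
    split_ifs with hz <;> simp [hz]
  simp only [ne_eq, h01]
  constructor
  · rintro (⟨h1, h2⟩ | ⟨h1, h2⟩)
    · exact ⟨x, h1, y, hy.resolve_left h2, rfl⟩
    · exact ⟨y, h1, x, hx.resolve_left h2, Finset.pair_comm _ _⟩
  · rintro ⟨u, hu, v, hv, huv⟩
    have h1 : x ∈ ({u, v} : Finset (Fin φ.n)) := huv ▸ by simp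
    have h2 : y ∈ ({u, v} : Finset (Fin φ.n)) := huv ▸ by simp
    simp only [Finset.mem_insert, Finset.mem_singleton] at h1 h2
    grind

/-- A red-blue bipartite subgraph need not come from a signature, but it lies below one that does;
this cofinality transfers maximality in both directions. -/
theorem isMaximalSignature_iff (σ : Fin φ.m → Bool) : φ.IsMaximalSignature σ ↔
    φ.toGraph.IsMaximalRedBlueBipartite (φ.subgraphOf σ) := by
  constructor
  · rintro ⟨h1, h2⟩
    refine ⟨h1.isRedBlueBipartite, fun K hK hle => ?_⟩
    obtain ⟨τ, hτ, hKτ⟩ := φ.exists_isSignature_le hK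
    exact hKτ.trans (φ.subgraphOf_le_iff.2 (h2 hτ (φ.subgraphOf_le_iff.1 (hle.trans hKτ))))
  · rintro ⟨h1, h2⟩
    obtain ⟨τ, hτ, hle⟩ := φ.exists_isSignature_le h1
    -- A maximal subgraph equals the signature subgraph above it, so `σ` is itself a signature.
    have : σ = τ := φ.subgraphOf_bijective.1 (le_antisymm hle (h2 hτ.isRedBlueBipartite hle))
    refine ⟨this ▸ hτ, fun ρ hρ hσρ => ?_⟩
    exact φ.subgraphOf_le_iff.1 (h2 hρ.isRedBlueBipartite (φ.subgraphOf_le_iff.2 hσρ))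

theorem bijOn_subgraphOf : Set.BijOn φ.subgraphOf {σ | φ.IsMaximalSignature σ}
    {H | φ.toGraph.IsMaximalRedBlueBipartite H} := by
  refine ⟨fun σ hσ => (φ.isMaximalSignature_iff σ).1 hσ, φ.subgraphOf_bijective.1.injOn, ?_⟩
  intro H hH
  obtain ⟨σ, rfl⟩ := φ.subgraphOf_bijective.2 H
  exact ⟨σ, (φ.isMaximalSignature_iff σ).2 hH, rfl⟩

theorem encodeSubgraph_subgraphOf (σ : Fin φ.m → Bool) :
    φ.toGraph.encodeSubgraph (φ.subgraphOf σ) = List.ofFn σ := by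
  refine congrArg List.ofFn (funext fun j => ?_)
  rw [Bool.eq_iff_iff, decide_eq_true_iff]
  exact φ.mem_subgraphOf

/-- The words to be listed are the same in both problems. -/
theorem image_encodeSubgraph :
    φ.toGraph.encodeSubgraph '' {H | φ.toGraph.IsMaximalRedBlueBipartite H} =
      List.ofFn '' {σ | φ.IsMaximalSignature σ} := by
  rw [← φ.bijOn_subgraphOf.image_eq, Set.image_image]
  exact Set.image_congr fun σ _ => φ.encodeSubgraph_subgraphOf σ

end GraphicXORCNF

/-! ### Rewriting the input of an enumeration machine -/

namespace List

/-- Translate a word letter by letter with `g`, but hold back the translation of every letter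
satisfying `hold` until the next such letter or the end of the word. The argument `buf` is the
letter held back at present. -/
def delayMap {A B : Type} (g : A → B) (hold : A → Bool) : Option B → List A → List B
  | buf, [] => buf.toList
  | buf, a :: w =>
    if hold a then buf.toList ++ delayMap g hold (some (g a)) w else g a :: delayMap g hold buf w

variable {A B : Type} {g : A → B} {hold : A → Bool}

theorem delayMap_cons_hold {a : A} (h : hold a = true) (buf : Option B) (w : List A) :
    delayMap g hold buf (a :: w) = buf.toList ++ delayMap g hold (some (g a)) w := by
  simp [delayMap, h]

theorem delayMap_append {u : List A} (h : ∀ a ∈ u, hold a = false) (buf : Option B) (w : List A) :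
    delayMap g hold buf (u ++ w) = u.map g ++ delayMap g hold buf w := by
  induction u with
  | nil => rfl
  | cons a u ih =>
    simp [delayMap, h a (by simp), ih fun b hb => h b (by simp [hb])]

/-- With these parameters `rewriteInput` merely reverses its input. -/
theorem delayMap_id (w : List A) : delayMap id (fun _ => false) none w = w := by
  simpa [delayMap] using
    delayMap_append (g := id) (hold := fun _ => false) (u := w) (by simp) none []

/-- Every letter read yields exactly one letter, possibly later. This controls the space used while
rewriting. -/
theorem length_delayMap (buf : Option B) (w : List A) :
    (delayMap g hold buf w).length = buf.toList.length + w.length := by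
  induction w generalizing buf with
  | nil => simp [delayMap]
  | cons a w ih =>
    rw [delayMap]
    split_ifs <;> simp [ih] <;> omega

end List

namespace EnumMachine

open Turing Turing.TM2

variable {A B O : Type}

/-- The machine `M` lists `S` on input `w`, with delay at most `d` and in space at most `b`. -/
def Lists (M : EnumMachine A O) (w : List A) (S : Set (List O)) (d b : ℕ) : Prop :=
  M.Enumerates w S ∧ M.DelayAtMost w d ∧ M.SpaceAtMost w b

/-! ### Embedding a program into a machine with one more stack -/

section AddStack

variable {K : Type} (A) (Γ : K → Type)

/-- The stack alphabets after the addition of a stack with alphabet `A`. -/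
abbrev AddStack : Option K → Type
  | none => A
  | some k => Γ k

variable {A Γ}

/-- The stack contents after the addition of a stack with content `w`. -/
def addStack (w : List A) (S : ∀ k, List (Γ k)) : ∀ k, List (AddStack A Γ k)
  | none => w
  | some k => S k

theorem update_addStack_none [DecidableEq K] (w w' : List A) (S : ∀ k, List (Γ k)) :
    Function.update (addStack w S) none w' = addStack w' S := by
  funext k
  cases k <;> simp [addStack]

theorem update_addStack_some [DecidableEq K] (w : List A) (S : ∀ k, List (Γ k)) (k : K)
    (x : List (Γ k)) :
    Function.update (addStack w S) (some k) x = addStack w (Function.update S k x) := by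
  funext k'
  cases k' with
  | none => simp [addStack]
  | some k' =>
    by_cases h : k' = k
    · subst h
      simp [addStack]
    · simp [addStack, h]

variable (A) in
/-- A program, run on a machine with one more stack, with one more label, and with additional
internal memory `X`, none of which it uses. -/
def liftStmt {Λ σ : Type} (X : Type) :
    Stmt Γ Λ σ → Stmt (AddStack A Γ) (Option Λ) (σ × X)
  | .push k f q => .push (some k) (fun v => f v.1) (liftStmt X q)
  | .peek k f q => .peek (some k) (fun v a => (f v.1 a, v.2)) (liftStmt X q)
  | .pop k f q => .pop (some k) (fun v a => (f v.1 a, v.2)) (liftStmt X q)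
  | .load f q => .load (fun v => (f v.1, v.2)) (liftStmt X q)
  | .branch f q₁ q₂ => .branch (fun v => f v.1) (liftStmt X q₁) (liftStmt X q₂)
  | .goto f => .goto fun v => some (f v.1)
  | .halt => .halt

variable (A) in
/-- A configuration in which the additional stack is empty and the additional memory is `x`. -/
def liftCfg {Λ σ X : Type} (x : X) (c : Cfg Γ Λ σ) : Cfg (AddStack A Γ) (Option Λ) (σ × X) :=
  ⟨c.l.map some, (c.var, x), addStack [] c.stk⟩

/-- A lifted program touches neither the new stack nor the new memory, so its execution commutes
with the embedding of configurations. -/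
theorem stepAux_liftStmt [DecidableEq K] {Λ σ X : Type} (x : X) (q : Stmt Γ Λ σ) (v : σ)
    (S : ∀ k, List (Γ k)) :
    stepAux (liftStmt A X q) (v, x) (addStack [] S) = liftCfg A x (stepAux q v S) := by
  induction q generalizing v S with
  | push k f q ih => simp only [liftStmt, stepAux, update_addStack_some, ← ih]; rfl
  | peek k f q ih => simp only [liftStmt, stepAux, ← ih]; rfl
  | pop k f q ih => simp only [liftStmt, stepAux, update_addStack_some, ← ih]; rfl
  | load f q ih => simp only [liftStmt, stepAux, ih]
  | branch f q₁ q₂ ih₁ ih₂ => simp only [liftStmt, stepAux, ih₁, ih₂]; cases f v <;> rfl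
  | goto f => rfl
  | halt => rfl

end AddStack

/-- The stacks of `tm` when the input stack contains `s` and the others are empty. -/
def inputStk (tm : FinTM2) (s : List (tm.Γ tm.k₀)) : ∀ k, List (tm.Γ k) :=
  Function.update (fun _ => []) tm.k₀ s

theorem initList_eq (tm : FinTM2) (s : List (tm.Γ tm.k₀)) :
    initList tm s = (⟨some tm.main, tm.initialState, inputStk tm s⟩ : Cfg _ _ _) := by
  unfold initList inputStk
  congr
  funext k
  by_cases h : k = tm.k₀
  · subst h
    simp
  · simp [h]

theorem update_inputStk (tm : FinTM2) (s s' : List (tm.Γ tm.k₀)) :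
    Function.update (inputStk tm s) tm.k₀ s' = inputStk tm s' := by
  simp [inputStk]

theorem inputStk_self (tm : FinTM2) (s : List (tm.Γ tm.k₀)) : inputStk tm s tm.k₀ = s := by
  simp [inputStk]

theorem sum_length_inputStk (tm : FinTM2) (s : List (tm.Γ tm.k₀)) :
    ∑ k ∈ tm.kFin.elems, (inputStk tm s k).length = s.length := by
  rw [Finset.sum_eq_single tm.k₀, inputStk_self]
  · intro k _ hk
    simp [inputStk, hk]
  · exact fun h => absurd (tm.kFin.complete _) h

/-! ### The rewriting machine -/

section Rewrite

variable [Fintype A] [Fintype B] [Inhabited B] (M : EnumMachine B O) (g : A → B) (hold : A → Bool)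

/-- The additional memory of `rewriteInput`: the letter held back, the letter to be written, and
whether the input has been exhausted. -/
abbrev RewriteMemory (B : Type) : Type := Option B × Option B × Bool

/-- The action of `rewriteInput` on its memory when it has read a letter, or the end of the
input. -/
def rewriteMemory (x : RewriteMemory B) : Option A → RewriteMemory B
  -- At the end of the input the letter held back is released.
  | none => (none, x.1, true)
  | some a => if hold a then (some (g a), x.1, false) else (x.1, some (g a), false)

/-- Leave the rewriting loop at the end of the input, and go round once more otherwise. -/
def rewriteNext : Stmt (AddStack A M.tm.Γ) (Option M.tm.Λ) (M.tm.σ × RewriteMemory B) :=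
  .branch (fun v => v.2.2.2)
    -- The memory is reset so that the simulation of `M` always runs with the same additional
    -- memory.
    (.load (fun v => (v.1, none, none, false)) (.goto fun _ => some M.tm.main))
    (.goto fun _ => none)

/-- The rewriting loop: read a letter and write at most one. -/
def rewriteLoop : Stmt (AddStack A M.tm.Γ) (Option M.tm.Λ) (M.tm.σ × RewriteMemory B) :=
  .pop none (fun v a => (v.1, rewriteMemory g hold v.2 a))
    (.branch (fun v => v.2.2.1.isSome)
      -- The default letter is never written: this branch is taken only if there is a letter to
      -- write.
      (.push (some M.tm.k₀) (fun v => M.inputAlphabet.symm (v.2.2.1.getD default)) M.rewriteNext)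
      M.rewriteNext)

/-- The machine that replaces its input `w` by the reverse of `w.delayMap g hold none`, and then
runs `M`. -/
def rewriteInput : EnumMachine A O where
  tm :=
    { K := Option M.tm.K
      kDecidableEq := inferInstance
      kFin := @instFintypeOption _ M.tm.kFin
      k₀ := none
      k₁ := some M.tm.k₁
      Γ := AddStack A M.tm.Γ
      Λ := Option M.tm.Λ
      main := none
      ΛFin := @instFintypeOption _ M.tm.ΛFin
      σ := M.tm.σ × RewriteMemory B
      initialState := (M.tm.initialState, none, none, false)
      σFin := @instFintypeProd _ _ M.tm.σFin _
      Γk₀Fin := inferInstanceAs (Fintype A)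
      m := fun l => match l with
        | none => M.rewriteLoop g hold
        | some l => liftStmt A (RewriteMemory B) (M.tm.m l) }
  finite_alphabets := fun k => match k with
    | none => inferInstanceAs (Finite A)
    | some k => M.finite_alphabets k
  inputAlphabet := Equiv.refl A
  outputAlphabet := M.outputAlphabet
  -- The loop label `none` is not an output label, so nothing is output during rewriting.
  outputLabels := some '' M.outputLabels

end Rewrite

end EnumMachine

/-! ### Runs, outputs and cost of the rewriting machine -/

namespace EnumMachine

open Turing Turing.TM2

variable {A B O : Type} [Fintype A] [Fintype B] [Inhabited B] (M : EnumMachine B O) (g : A → B)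
  (hold : A → Bool)

theorem run_succ {I : Type} (N : EnumMachine I O) (w : List I) (t : ℕ) :
    N.run w (t + 1) = (N.run w t).bind N.tm.step :=
  Function.iterate_succ_apply' _ _ _

/-- A configuration of `rewriteInput` in the rewriting loop: `w` is still to be read, and `s` has
been written. -/
def rewriteCfg (x : RewriteMemory B) (w : List A) (s : List (M.tm.Γ M.tm.k₀)) :
    (M.rewriteInput g hold).tm.Cfg :=
  (⟨some none, (M.tm.initialState, x), addStack w (inputStk M.tm s)⟩ : Cfg _ _ _)

/-- The configuration of `rewriteInput` corresponding to a configuration of `M`. -/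
def simCfg (c : M.tm.Cfg) : (M.rewriteInput g hold).tm.Cfg :=
  liftCfg A ((none, none, false) : RewriteMemory B) c

theorem step_simCfg (c : M.tm.Cfg) : (M.rewriteInput g hold).tm.step (M.simCfg g hold c) =
    (M.tm.step c).map (M.simCfg g hold) := by
  rcases c with ⟨_ | l, v, S⟩
  · rfl
  · exact congrArg some (stepAux_liftStmt _ _ _ _)

theorem run_rewriteInput_zero (w : List A) : (M.rewriteInput g hold).run w 0 =
    some (M.rewriteCfg g hold (none, none, false) w []) := by
  refine congrArg some ((initList_eq _ _).trans ?_)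
  unfold rewriteCfg
  congr
  funext k
  cases k with
  | none => exact (inputStk_self _ _).trans (List.map_id w)
  | some k =>
    have h : (some k : Option M.tm.K) ≠ none := by simp
    refine (Function.update_of_ne h _ _).trans ?_
    by_cases hk : k = M.tm.k₀
    · subst hk
      exact (inputStk_self _ _).symm
    · change [] = inputStk M.tm [] k
      simp [inputStk, hk]

theorem step_rewriteCfg_hold {a : A} (ha : hold a = true) (buf e : Option B) (w : List A)
    (s : List (M.tm.Γ M.tm.k₀)) :
    (M.rewriteInput g hold).tm.step (M.rewriteCfg g hold (buf, e, false) (a :: w) s) =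
      some (M.rewriteCfg g hold (some (g a), buf, false) w
        ((buf.toList.map M.inputAlphabet.symm) ++ s)) := by
  refine congrArg some ?_
  change stepAux (M.rewriteLoop g hold) _ _ = _
  cases buf <;>
  simp [rewriteLoop, rewriteNext, rewriteMemory, rewriteCfg, ha, update_addStack_none,
    update_addStack_some, addStack, inputStk_self, update_inputStk]

theorem step_rewriteCfg_not_hold {a : A} (ha : hold a = false) (buf e : Option B) (w : List A)
    (s : List (M.tm.Γ M.tm.k₀)) :
    (M.rewriteInput g hold).tm.step (M.rewriteCfg g hold (buf, e, false) (a :: w) s) =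
      some (M.rewriteCfg g hold (buf, some (g a), false) w (M.inputAlphabet.symm (g a) :: s)) := by
  refine congrArg some ?_
  change stepAux (M.rewriteLoop g hold) _ _ = _
  simp [rewriteLoop, rewriteNext, rewriteMemory, rewriteCfg, ha, update_addStack_none,
    update_addStack_some, addStack, inputStk_self, update_inputStk]

theorem step_rewriteCfg_nil (buf e : Option B) (s : List (M.tm.Γ M.tm.k₀)) :
    (M.rewriteInput g hold).tm.step (M.rewriteCfg g hold (buf, e, false) [] s) =
      some (M.simCfg g hold (initList M.tm ((buf.toList.map M.inputAlphabet.symm) ++ s))) := by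
  refine congrArg some ?_
  rw [initList_eq]
  change stepAux (M.rewriteLoop g hold) _ _ = _
  cases buf <;>
  simp [rewriteLoop, rewriteNext, rewriteMemory, simCfg, liftCfg, update_addStack_none,
    update_addStack_some, addStack, inputStk_self, update_inputStk]

/-- While the input is being rewritten, the configuration stays in the rewriting loop, and what is
still to be read, held back or already written determines the word finally written. -/
theorem run_rewriteInput_of_le (w : List A) (t : ℕ) (ht : t ≤ w.length) :
    ∃ buf e s, (M.rewriteInput g hold).run w t =
        some (M.rewriteCfg g hold (buf, e, false) (w.drop t) s) ∧
      (((w.drop t).delayMap g hold buf).map M.inputAlphabet.symm).reverse ++ s =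
        ((w.delayMap g hold none).map M.inputAlphabet.symm).reverse := by
  induction t with
  | zero => exact ⟨none, none, [], M.run_rewriteInput_zero g hold w, by simp⟩
  | succ t ih =>
    obtain ⟨buf, e, s, h1, h2⟩ := ih (by omega)
    have hd : w.drop t = w[t] :: w.drop (t + 1) := List.drop_eq_getElem_cons (by omega)
    rw [hd] at h1 h2
    rw [run_succ, h1, Option.bind_some]
    cases ha : hold w[t] with
    | true =>
      refine ⟨_, _, _, M.step_rewriteCfg_hold g hold ha _ _ _ _, ?_⟩
      rw [← h2, List.delayMap_cons_hold ha]
      cases buf <;> simp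
    | false =>
      refine ⟨_, _, _, M.step_rewriteCfg_not_hold g hold ha _ _ _ _, ?_⟩
      rw [← h2]
      simp [List.delayMap, ha]

/-- After the input has been rewritten, `M` is simulated step by step. -/
theorem run_rewriteInput_add (w : List A) (t : ℕ) :
    (M.rewriteInput g hold).run w (w.length + 1 + t) =
      (M.run (w.delayMap g hold none).reverse t).map (M.simCfg g hold) := by
  induction t with
  | zero =>
    obtain ⟨buf, e, s, h1, h2⟩ := M.run_rewriteInput_of_le g hold w w.length le_rfl
    rw [List.drop_length] at h1 h2
    -- The step beyond `w.length` finds the input exhausted, writes the letter still held back and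
    -- enters `M`.
    rw [Nat.add_zero, run_succ, h1, Option.bind_some, step_rewriteCfg_nil]
    refine congrArg (fun s => some (M.simCfg g hold (initList M.tm s))) ?_
    rw [List.map_reverse, ← h2]
    cases buf <;> simp [List.delayMap]
  | succ t ih =>
    rw [← Nat.add_assoc, run_succ, ih, run_succ]
    cases M.run (w.delayMap g hold none).reverse t with
    | none => rfl
    | some c => exact M.step_simCfg g hold c

theorem outputsAt_rewriteInput_add (w : List A) (t : ℕ) (out : List O) :
    (M.rewriteInput g hold).OutputsAt w (w.length + 1 + t) out ↔
      M.OutputsAt (w.delayMap g hold none).reverse t out := by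
  unfold OutputsAt
  rw [run_rewriteInput_add]
  constructor
  · rintro ⟨c', hc', ⟨l', ⟨l, hl, rfl⟩, hl'⟩, hout⟩
    obtain ⟨c, hc, rfl⟩ := Option.map_eq_some_iff.1 hc'
    obtain ⟨l₁, hl₁, h⟩ := Option.map_eq_some_iff.1 hl'
    cases h
    exact ⟨c, hc, ⟨l, hl, hl₁⟩, hout⟩
  · rintro ⟨c, hc, ⟨l, hl, hl'⟩, hout⟩
    exact ⟨M.simCfg g hold c, by rw [hc]; rfl,
      ⟨some l, ⟨l, hl, rfl⟩, congrArg (Option.map some) hl'⟩, hout⟩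

/-- Up to time `w.length` the control is at the loop label, so every output comes from the
simulation of `M`. -/
theorem outputsAt_rewriteInput (w : List A) (t : ℕ) (out : List O) :
    (M.rewriteInput g hold).OutputsAt w t out ↔
      ∃ s, t = w.length + 1 + s ∧ M.OutputsAt (w.delayMap g hold none).reverse s out := by
  constructor
  · intro h
    by_cases ht : t ≤ w.length
    · obtain ⟨buf, e, s, h1, -⟩ := M.run_rewriteInput_of_le g hold w t ht
      obtain ⟨c, hc, ⟨l', ⟨l, hl, rfl⟩, hl'⟩, -⟩ := h
      rw [h1] at hc
      cases hc
      cases hl'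
    · obtain ⟨s, rfl⟩ := Nat.exists_eq_add_of_le (show w.length + 1 ≤ t by omega)
      exact ⟨s, rfl, (M.outputsAt_rewriteInput_add g hold w s out).1 h⟩
  · rintro ⟨s, rfl, h⟩
    exact (M.outputsAt_rewriteInput_add g hold w s out).2 h

theorem sum_length_addStack (w : List A) (S : ∀ k, List (M.tm.Γ k)) :
    ∑ k ∈ (M.rewriteInput g hold).tm.kFin.elems, (addStack w S k).length =
      w.length + ∑ k ∈ M.tm.kFin.elems, (S k).length :=
  letI := M.tm.kFin
  Fintype.sum_option fun k => (addStack w S k).length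

/-- Rewriting the input costs linear time and space. -/
theorem Lists.rewriteInput {w : List A} {S : Set (List O)} {d b : ℕ}
    (h : M.Lists (w.delayMap g hold none).reverse S d b) :
    (M.rewriteInput g hold).Lists w S (d + w.length + 1) (b + w.length) := by
  obtain ⟨⟨h1, h2⟩, h3, h4⟩ := h
  refine ⟨⟨fun out => ?_, ?_⟩, ?_, ?_⟩
  · rw [← h1]
    simp only [outputsAt_rewriteInput]
    exact ⟨fun ⟨_, s, _, h⟩ => ⟨s, h⟩, fun ⟨s, h⟩ => ⟨_, s, rfl, h⟩⟩
  · intro s t out hs ht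
    rw [outputsAt_rewriteInput] at hs ht
    obtain ⟨s, rfl, hs⟩ := hs
    obtain ⟨t, rfl, ht⟩ := ht
    rw [h2 s t out hs ht]
  · have key : ∀ t, M.run (w.delayMap g hold none).reverse t ≠ none →
        ∃ s, t < s ∧ s ≤ t + d ∧ ((M.rewriteInput g hold).run w (w.length + 1 + s) = none ∨
          ∃ out, (M.rewriteInput g hold).OutputsAt w (w.length + 1 + s) out) := by
      intro t ht
      obtain ⟨s, hs1, hs2, hs⟩ := h3 t ht
      refine ⟨s, hs1, hs2, ?_⟩
      simp only [run_rewriteInput_add, outputsAt_rewriteInput_add, Option.map_eq_none_iff]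
      exact hs
    intro t ht
    by_cases hw : t ≤ w.length
    -- From within the loop, the rest of the rewriting takes at most `w.length + 1` steps, and then
    -- the delay of `M` from its start applies.
    · obtain ⟨s, hs1, hs2, hs⟩ := key 0 (by simp [run])
      exact ⟨_, by omega, by omega, hs⟩
    · obtain ⟨t, rfl⟩ := Nat.exists_eq_add_of_le (show w.length + 1 ≤ t by omega)
      rw [run_rewriteInput_add, ne_eq, Option.map_eq_none_iff] at ht
      obtain ⟨s, hs1, hs2, hs⟩ := key t ht
      exact ⟨_, by omega, by omega, hs⟩
  · intro t c hc
    by_cases hw : t ≤ w.length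
    · obtain ⟨buf, e, s, hs1, hs2⟩ := M.run_rewriteInput_of_le g hold w t hw
      rw [hs1] at hc
      cases hc
      -- The letters unread, held back and written always number `w.length` in total.
      have hlen := congrArg List.length hs2
      simp only [List.length_append, List.length_reverse, List.length_map, List.length_delayMap,
        Option.toList_none, List.length_nil] at hlen
      refine (M.sum_length_addStack g hold _ _).le.trans ?_
      rw [sum_length_inputStk]
      omega
    · obtain ⟨t, rfl⟩ := Nat.exists_eq_add_of_le (show w.length + 1 ≤ t by omega)
      rw [run_rewriteInput_add] at hc
      obtain ⟨c, hc', rfl⟩ := Option.map_eq_some_iff.1 hc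
      refine (M.sum_length_addStack g hold _ _).le.trans ?_
      have := h4 t c hc'
      simp only [List.length_nil]
      omega

end EnumMachine

/-! ### Translating formulas and multigraphs into one another -/

noncomputable instance : Fintype FormulaSym :=
  ⟨{.tick, .bit true, .bit false, .plus, .rhs 0, .rhs 1}, by
    have h : ∀ ε : ZMod 2, ε = 0 ∨ ε = 1 := by decide
    rintro (_ | (_ | _) | _ | ε)
    on_goal 5 => rcases h ε with rfl | rfl
    all_goals simp⟩

instance : Fintype GraphSym :=
  ⟨{.tick, .bit true, .bit false, .sep, .color .red, .color .blue}, by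
    rintro (_ | (_ | _) | _ | (_ | _)) <;> simp⟩

instance : Inhabited FormulaSym := ⟨.tick⟩

instance : Inhabited GraphSym := ⟨.tick⟩

/-- The letter of a multigraph that corresponds to a letter of a formula. -/
def FormulaSym.toGraphSym : FormulaSym → GraphSym
  | .tick => .tick
  | .bit b => .bit b
  | .plus => .sep
  | .rhs ε => .color (if ε = 1 then .blue else .red)

/-- The letter of a formula that corresponds to a letter of a multigraph. -/
def GraphSym.toFormulaSym : GraphSym → FormulaSym
  | .tick => .tick
  | .bit b => .bit b
  | .sep => .plus
  | .color .blue => .rhs 1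
  | .color .red => .rhs 0

/-- The letters whose order is changed when a formula is read from its end. -/
def FormulaSym.isHeld : FormulaSym → Bool
  -- Read from the end, the ticks follow the first clause. The first tick must release the color of
  -- that clause; each later one releases its predecessor.
  | .tick => true
  | .rhs _ => true
  | _ => false

/-- The letters whose order is changed when a multigraph is read from its beginning. -/
def GraphSym.isHeld : GraphSym → Bool
  | .color _ => true
  | _ => false

theorem GraphSym.toFormulaSym_color (ε : ZMod 2) :
    GraphSym.toFormulaSym (.color (if ε = 1 then .blue else .red)) = .rhs ε := by
  revert ε
  decide

section Translate

variable {n : ℕ}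

/-- The two end points of an edge, as written in a formula. -/
def encodeVars (V : Finset (Fin n)) : List FormulaSym :=
  (V.sort (· ≤ ·)).flatMap fun x : Fin n => encodeNatSep FormulaSym.bit FormulaSym.plus x

/-- The two end points of an edge, as written in a multigraph. -/
def encodeEnds (V : Finset (Fin n)) : List GraphSym :=
  (V.sort (· ≤ ·)).flatMap fun x : Fin n => encodeNatSep GraphSym.bit GraphSym.sep x

theorem map_encodeVars (V : Finset (Fin n)) :
    (encodeVars V).map FormulaSym.toGraphSym = encodeEnds V := by
  simp [encodeVars, encodeEnds, encodeNatSep, List.map_flatMap, Function.comp_def,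
    FormulaSym.toGraphSym]

theorem map_encodeEnds (V : Finset (Fin n)) :
    (encodeEnds V).map GraphSym.toFormulaSym = encodeVars V := by
  simp [encodeVars, encodeEnds, encodeNatSep, List.map_flatMap, Function.comp_def,
    GraphSym.toFormulaSym]

theorem isHeld_of_mem_encodeVars {V : Finset (Fin n)} {a : FormulaSym} (ha : a ∈ encodeVars V) :
    a.isHeld = false := by
  simp only [encodeVars, encodeNatSep, List.mem_flatMap, List.mem_append, List.mem_map,
    List.mem_singleton] at ha
  obtain ⟨_, -, ⟨_, -, rfl⟩ | rfl⟩ := ha <;> rfl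

theorem isHeld_of_mem_encodeEnds {V : Finset (Fin n)} {a : GraphSym} (ha : a ∈ encodeEnds V) :
    a.isHeld = false := by
  simp only [encodeEnds, encodeNatSep, List.mem_flatMap, List.mem_append, List.mem_map,
    List.mem_singleton] at ha
  obtain ⟨_, -, ⟨_, -, rfl⟩ | rfl⟩ := ha <;> rfl

theorem XORClause.encode_eq (C : XORClause n) : C.encode = encodeVars C.vars ++ [.rhs C.rhs] := rfl

theorem XORClause.encode_toEdge (C : XORClause n) : C.toEdge.encode =
    .color (if C.rhs = 1 then .blue else .red) :: encodeEnds C.vars := rfl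

/-- Each color waits for the next color or the end of the word, and so lands just behind its own end
points. An arbitrary `buf` is needed for the induction, since each edge leaves its color to the
next. -/
theorem delayMap_flatMap_encode_toEdge (l : List (XORClause n)) (buf : Option FormulaSym) :
    (l.flatMap fun C => C.toEdge.encode).delayMap GraphSym.toFormulaSym GraphSym.isHeld buf =
      buf.toList ++ l.flatMap XORClause.encode := by
  induction l generalizing buf with
  | nil => simp [List.delayMap]
  | cons C l ih =>
    rw [List.flatMap_cons, XORClause.encode_toEdge, List.cons_append,
      List.delayMap_cons_hold rfl, List.delayMap_append fun a => isHeld_of_mem_encodeEnds,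
      ih, map_encodeEnds, GraphSym.toFormulaSym_color, List.flatMap_cons, XORClause.encode_eq]
    simp

theorem delayMap_replicate_tick (k : ℕ) (buf : Option GraphSym) :
    (List.replicate k FormulaSym.tick).delayMap FormulaSym.toGraphSym FormulaSym.isHeld buf =
      buf.toList ++ List.replicate k GraphSym.tick := by
  induction k generalizing buf with
  | zero => simp [List.delayMap]
  | succ k ih =>
    rw [List.replicate_succ, List.delayMap_cons_hold rfl, ih]
    rfl

/-- In a reversed clause the right-hand side comes first, so holding it back puts it behind the
reversed end points, where a reversed edge has its color. -/
theorem delayMap_flatMap_reverse_encode (l : List (XORClause n)) (k : ℕ) (buf : Option GraphSym) :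
    ((l.flatMap fun C => C.encode.reverse) ++ List.replicate k FormulaSym.tick).delayMap
        FormulaSym.toGraphSym FormulaSym.isHeld buf =
      buf.toList ++ (l.flatMap fun C => C.toEdge.encode.reverse) ++
        List.replicate k GraphSym.tick := by
  induction l generalizing buf with
  | nil => simpa using delayMap_replicate_tick k buf
  | cons C l ih =>
    rw [List.flatMap_cons, XORClause.encode_eq, List.reverse_append, List.append_assoc,
      List.append_assoc, List.reverse_singleton, List.singleton_append,
      List.delayMap_cons_hold rfl,
      List.delayMap_append fun a ha => isHeld_of_mem_encodeVars (List.mem_reverse.1 ha),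
      ih, List.map_reverse, map_encodeVars, List.flatMap_cons, XORClause.encode_toEdge]
    simp [FormulaSym.toGraphSym]

end Translate

namespace GraphicXORCNF

variable (φ : GraphicXORCNF)

theorem encode_toGraph : φ.toGraph.encode = List.replicate φ.n GraphSym.tick ++
    (List.ofFn φ.clause).flatMap fun C => C.toEdge.encode := by
  change _ ++ (List.ofFn fun j => (φ.clause j).toEdge).flatMap _ = _
  rw [← Function.comp_def XORClause.toEdge, ← List.map_ofFn, List.flatMap_map]

/-- The description of the formula of a multigraph is obtained by reading the description of the
multigraph from its beginning. -/
theorem delayMap_encode_toGraph :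
    φ.toGraph.encode.delayMap GraphSym.toFormulaSym GraphSym.isHeld none = φ.encode := by
  rw [encode_toGraph, List.delayMap_append, delayMap_flatMap_encode_toEdge]
  · simp [encode, GraphSym.toFormulaSym]
  · intro a ha
    rw [List.eq_of_mem_replicate ha]
    rfl

/-- The description of the multigraph of a formula is obtained by reading the description of the
formula from its end. -/
theorem reverse_delayMap_reverse_encode :
    (φ.encode.reverse.delayMap FormulaSym.toGraphSym FormulaSym.isHeld none).reverse =
      φ.toGraph.encode := by
  rw [encode_toGraph, encode, List.reverse_append, List.reverse_flatMap, List.reverse_replicate]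
  refine (congrArg List.reverse (delayMap_flatMap_reverse_encode _ _ _)).trans ?_
  simp [List.reverse_flatMap, Function.comp_def]

/-- Allows the same polynomials to bound the cost for both problems. -/
theorem length_encode_toGraph : φ.toGraph.encode.length = φ.encode.length := by
  rw [← φ.delayMap_encode_toGraph, List.length_delayMap]
  simp

end GraphicXORCNF

theorem theorem4p3 :
    (maximalSignatures.PolyDelayPolySpace ↔
      maximalRedBlueBipartiteSubgraphs.PolyDelayPolySpace) ∧
    Function.Bijective GraphicXORCNF.toGraph ∧
    ∀ φ : GraphicXORCNF,
      (∀ σ : Fin φ.m → Bool, φ.IsMaximalSignature σ ↔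
        φ.toGraph.IsMaximalRedBlueBipartite (φ.subgraphOf σ)) ∧
      Set.BijOn φ.subgraphOf {σ | φ.IsMaximalSignature σ}
        {H | φ.toGraph.IsMaximalRedBlueBipartite H} := by
  refine ⟨⟨?_, ?_⟩, GraphicXORCNF.toGraph_bijective,
    fun φ => ⟨φ.isMaximalSignature_iff, φ.bijOn_subgraphOf⟩⟩
  · rintro ⟨M, d, b, hM⟩
    -- The outer pass acts first: it translates the multigraph from its beginning and leaves the
    -- formula reversed, which the inner pass turns round. Each pass adds `X + 1` to the delay and
    -- `X` to the space.
    refine ⟨(M.rewriteInput id fun _ => false).rewriteInput GraphSym.toFormulaSym GraphSym.isHeld,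
      d + (Polynomial.X + 1 + Polynomial.X + 1), b + (Polynomial.X + Polynomial.X), fun G => ?_⟩
    obtain ⟨φ, rfl⟩ := GraphicXORCNF.toGraph_bijective.2 G
    have h : M.Lists φ.encode _ _ _ := hM φ
    change M.Lists _ (List.ofFn '' {σ | φ.IsMaximalSignature σ}) (d.eval φ.encode.length)
      (b.eval φ.encode.length) at h
    rw [← φ.image_encodeSubgraph, ← φ.length_encode_toGraph, ← List.reverse_reverse φ.encode,
      ← List.delayMap_id φ.encode.reverse] at h
    have h' := h.rewriteInput
    rw [← φ.delayMap_encode_toGraph] at h'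
    have h'' := h'.rewriteInput
    simpa [EnumMachine.Lists, List.length_delayMap, List.delayMap_id, add_assoc] using h''
  · rintro ⟨M, d, b, hM⟩
    -- Here the reversal acts first, because a formula has to be translated from its end; the
    -- translating pass then restores the direction.
    refine ⟨(M.rewriteInput FormulaSym.toGraphSym FormulaSym.isHeld).rewriteInput id
      fun _ => false,
      d + (Polynomial.X + 1 + Polynomial.X + 1), b + (Polynomial.X + Polynomial.X), fun φ => ?_⟩
    have h : M.Lists φ.toGraph.encode _ _ _ := hM φ.toGraph
    change M.Lists _ (φ.toGraph.encodeSubgraph '' {H | φ.toGraph.IsMaximalRedBlueBipartite H})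
      (d.eval φ.toGraph.encode.length) (b.eval φ.toGraph.encode.length) at h
    rw [φ.image_encodeSubgraph, φ.length_encode_toGraph, ← φ.reverse_delayMap_reverse_encode] at h
    have h' := h.rewriteInput
    rw [← List.delayMap_id φ.encode] at h'
    have h'' := h'.rewriteInput
    simpa [EnumMachine.Lists, List.length_delayMap, List.delayMap_id, add_assoc] using h''
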